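/- Let $d\ge 1$, let $\lambda>0$, and let $V,\psi:\mathbb R^d\to\mathbb R$ satisfy the following assumptions ($|\cdot|$ is the Euclidean norm). Assumptions on $V$: (V1) $V$ is $C^\infty$ and there are an integer $m\ge1$ and $C_{2m}>0$ with $\lim_{|x|\to\infty}V(x)/|x|^{2m}=C_{2m}$; (V2) the equation $\nabla V(x)=0$ has finitely many solutions; (V3) there are $C_2,C_4>0$ with $V(x)\ge C_4|x|^4-C_2|x|^2$ for all $x\in\mathbb R^d$; (V4) $\mathrm{Hess}\,V(x)\to+\infty$ as $|x|\to\infty$ (i.e. the smallest eigenvalue of $\mathrm{Hess}\,V(x)$ tends to $+\infty$), and there is a compact set $K\subset\mathbb R^d$ containing all the critical points of $V$ such that $\mathrm{Hess}\,V(x)$ is positive definite for all $x\notin K$. Assumptions on $\psi$: there is an even real polynomial $G$ on $\mathbb R$ of degree $2n\ge2$ such that $\psi(x)=G(|x|)$ for all $x\in\mathbb R^d$, $G$ and $G''$ are convex, and $G(0)=0$. Consider the (dimensionless) Vlasov--Fokker--Planck equation on $\mathbb R^d\times\mathbb R^d\ni(q,p)$, $$\partial_t\rho=\mathsf K[\rho](\rho),\qquad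 \mathsf K[\mu](\rho):=-\operatorname{div}_q(\rho\,p)+\operatorname{div}_p\big(\rho\,(\nabla_qV+\nabla_q\psi*\mu+p)\big)+\lambda\Delta_p\rho,$$ where $(\nabla_q\psi*\mu)(q)=\int_{\mathbb R^{2d}}\nabla\psi(q-q')\,\mu(q',p')\,dq'\,dp'$. An invariant probability of this equation is a probability measure on $\mathbb R^{2d}$ with a nonnegative density $\rho\in C^\infty\cap L^1\cap L^\infty$ with respect to Lebesgue measure such that the integrals defining $\psi*\rho$ and $\nabla\psi*\rho$ converge absolutely and $\mathsf K[\rho](\rho)=0$ pointwise on $\mathbb R^{2d}$. If both $V$ and $\psi$ are even, then the equation admits an invariant probability whose density $\rho$ with respect to Lebesgue measure is even, i.e. $\rho(-q,-p)=\rho(q,p)$ for all $(q,p)\in\mathbb R^{2d}$. -/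

import Mathlib

open MeasureTheory Filter Topology Bornology
open scoped ContDiff

noncomputable section

namespace VFP

/-- The position space (and the momentum space) `ℝᵈ` with its Euclidean norm. -/
abbrev Pos (d : ℕ) : Type := EuclideanSpace ℝ (Fin d)

/-- The phase space `ℝᵈ × ℝᵈ` of pairs `(q, p)`; its `volume` is Lebesgue measure on `ℝ²ᵈ`. -/
abbrev Phase (d : ℕ) : Type := Pos d × Pos d

/-- The Hessian quadratic form `⟨Hess V(x) v, v⟩`. -/
def hess {d : ℕ} (V : Pos d → ℝ) (x v : Pos d) : ℝ :=
  fderiv ℝ (fderiv ℝ V) x v v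

/-- The divergence `∑ᵢ ∂ᵢ Fᵢ` of a vector field on `ℝᵈ`. -/
def divergence {d : ℕ} (F : Pos d → Pos d) (x : Pos d) : ℝ :=
  ∑ i : Fin d, fderiv ℝ F x (EuclideanSpace.single i 1) i

/-- Assumptions on the confining potential `V`. -/
structure ConfiningPotential {d : ℕ} (V : Pos d → ℝ) : Prop where
  smooth : ContDiff ℝ ∞ V
  growth : ∃ m : ℕ, 1 ≤ m ∧ ∃ C : ℝ, 0 < C ∧
    Tendsto (fun x => V x / ‖x‖ ^ (2 * m)) (cobounded (Pos d)) (𝓝 C)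
  finite_critical : {x | gradient V x = 0}.Finite
  quartic_lower : ∃ C₄ C₂ : ℝ, 0 < C₄ ∧ 0 < C₂ ∧
    ∀ x, C₄ * ‖x‖ ^ 4 - C₂ * ‖x‖ ^ 2 ≤ V x
  hess_tendsto : ∀ M : ℝ, ∀ᶠ x in cobounded (Pos d), ∀ v, M * ‖v‖ ^ 2 ≤ hess V x v
  hess_pos : ∃ K : Set (Pos d), IsCompact K ∧ {x | gradient V x = 0} ⊆ K ∧
    ∀ x ∉ K, ∀ v ≠ 0, 0 < hess V x v

/-- Assumptions on the interaction potential `ψ`: it is `G(|x|)` for an even real polynomial `G`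
of degree `2n ≥ 2` with `G(0) = 0` such that `G` and `G''` are convex. -/
def InteractionPotential {d : ℕ} (ψ : Pos d → ℝ) : Prop :=
  ∃ G : Polynomial ℝ,
    Function.Even (fun r : ℝ => G.eval r) ∧
    (∀ x, ψ x = G.eval ‖x‖) ∧
    (∃ n : ℕ, 1 ≤ n ∧ G.natDegree = 2 * n) ∧
    ConvexOn ℝ Set.univ (fun r : ℝ => G.eval r) ∧
    ConvexOn ℝ Set.univ (fun r : ℝ => G.derivative.derivative.eval r) ∧
    G.eval 0 = 0

/-- `(∇ψ ∗ μ)(q) = ∫ ∇ψ(q - q') μ(q', p') dq' dp'`. -/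
def gradConv {d : ℕ} (ψ : Pos d → ℝ) (μ : Phase d → ℝ) (q : Pos d) : Pos d :=
  ∫ z : Phase d, μ z • gradient ψ (q - z.1)

/-- The operator
`K[μ](ρ) = - div_q (ρ p) + div_p (ρ (∇V + ∇ψ ∗ μ + p)) + lam Δ_p ρ` at the point `(q, p)`. -/
def K {d : ℕ} (V ψ : Pos d → ℝ) (lam : ℝ) (μ ρ : Phase d → ℝ) (q p : Pos d) : ℝ :=
  - divergence (fun x => ρ (x, p) • p) q
  + divergence (fun y => ρ (q, y) • (gradient V q + gradConv ψ μ q + y)) p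
  + lam * Laplacian.laplacian (fun y => ρ (q, y)) p

/-- `ρ` is a stationary solution of the Vlasov-Fokker-Planck equation in `L¹ ∩ L^∞`: it is smooth,
the convolutions `ψ ∗ ρ` and `∇ψ ∗ ρ` are absolutely convergent, and `K[ρ](ρ) = 0` pointwise. -/
structure IsStationarySolution {d : ℕ} (V ψ : Pos d → ℝ) (lam : ℝ) (ρ : Phase d → ℝ) :
    Prop where
  smooth : ContDiff ℝ ∞ ρ
  integrable : Integrable ρ
  bounded : ∃ C : ℝ, ∀ z, |ρ z| ≤ C
  conv_integrable : ∀ q, Integrable (fun z : Phase d => ρ z * ψ (q - z.1))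
  gradConv_integrable : ∀ q, Integrable (fun z : Phase d => ρ z • gradient ψ (q - z.1))
  stationary : ∀ q p, K V ψ lam ρ ρ q p = 0

/-- The probability measure `μ` is invariant for the Vlasov-Fokker-Planck equation and `ρ` is its
(smooth) density with respect to Lebesgue measure. -/
structure IsInvariantProbability {d : ℕ} (V ψ : Pos d → ℝ) (lam : ℝ)
    (μ : Measure (Phase d)) (ρ : Phase d → ℝ) : Prop where
  prob : IsProbabilityMeasure μ
  nonneg : ∀ z, 0 ≤ ρ z
  density : μ = volume.withDensity (fun z => ENNReal.ofReal (ρ z))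
  solution : IsStationarySolution V ψ lam ρ

end VFP

end

/-! A normalised product `exp (-U q / lam) * exp (-|p|² / (2 lam))` is stationary as soon as `∇U =
∇V + ∇ψ ∗ ρ`, so it suffices to find an even `U` solving this self-consistency equation
(`exists_selfConsistent_potential`, `kinetic_gibbsDensity_eq_zero`).

Since `ψ x = g (|x|²)` with `g` a polynomial, `ψ (x - y) - ψ x - ψ y` is a finite sum `∑ c i * u i x
* u i y` (`InteractionPotential.exists_diagonal`). The equation thus becomes a fixed-point problem
for a vector `m` of moments, with `U = V + ψ + ∑ c i * m i * w i`, where `w i` is the even part of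
`u i`. The `u i` have lower order than `ψ`, so all exponential moments relative to `exp (-(V + ψ) /
lam)` are finite; convexity of `G` serves to make the leading coefficient of `ψ` positive.

The vector `m` minimises the free energy `sup_η (η ⬝ᵥ m - log Z(η)) + (ε * m) ⬝ᵥ m / 2`, and
stationarity at the minimum is the fixed-point equation (`exists_tiltedMoment_eq`). The quadratic
form may be indefinite, but convexity of `G''` makes `g` convex on `[0, ∞)`, so the even kernel `∑ c
i * w i x * w i y` is pointwise nonnegative (`radial_symm_nonneg`). The form is then nonnegative on
a closed convex cone containing all the moment vectors, which makes the problem coercive there. -/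

noncomputable section

namespace VFP

/-! ### The cone on which the indefinite interaction form is nonnegative. -/

section PairingCone

variable {X κ : Type*} [Fintype κ] {T : X → κ → ℝ}

/-- Vectors that pair nonnegatively with everything that pairs nonnegatively with `T`. -/
def pairingCone (T : X → κ → ℝ) (ε : κ → ℝ) : Set (κ → ℝ) :=
  {a | ∀ b : κ → ℝ, (∀ y, 0 ≤ (ε * b) ⬝ᵥ T y) → 0 ≤ (ε * b) ⬝ᵥ a}

theorem mul_dotProduct_comm (ε a b : κ → ℝ) : (ε * a) ⬝ᵥ b = (ε * b) ⬝ᵥ a := by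
  simp only [dotProduct, Pi.mul_apply]
  exact Finset.sum_congr rfl fun _ _ => by ring

theorem isClosed_pairingCone (T : X → κ → ℝ) (ε : κ → ℝ) : IsClosed (pairingCone T ε) := by
  have h : pairingCone T ε = ⋂ (b : κ → ℝ) (_ : ∀ y, 0 ≤ (ε * b) ⬝ᵥ T y),
      {a | 0 ≤ (ε * b) ⬝ᵥ a} := by
    ext; simp [pairingCone]
  rw [h]
  refine isClosed_iInter fun b => isClosed_iInter fun _ => ?_
  exact isClosed_le continuous_const (by unfold dotProduct; fun_prop)

/-- Each `T x` is an admissible test vector, so `a` pairs nonnegatively with every `T x`; by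
symmetry `a` is itself an admissible test vector. -/
theorem pairing_self_nonneg {ε a : κ → ℝ} (hpos : ∀ x y, 0 ≤ (ε * T x) ⬝ᵥ T y)
    (ha : a ∈ pairingCone T ε) : 0 ≤ (ε * a) ⬝ᵥ a :=
  ha a fun y => by rw [mul_dotProduct_comm]; exact ha (T y) (hpos y)

theorem combo_mem_pairingCone {ε a b : κ → ℝ} (ha : a ∈ pairingCone T ε)
    (hb : b ∈ pairingCone T ε) {t : ℝ} (h0 : 0 ≤ t) (h1 : t ≤ 1) :
    (1 - t) • a + t • b ∈ pairingCone T ε := by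
  intro c hc
  rw [dotProduct_add, dotProduct_smul, dotProduct_smul]
  exact add_nonneg (mul_nonneg (by linarith) (ha c hc)) (mul_nonneg h0 (hb c hc))

end PairingCone

/-! ### Exponential families and minimisation of the free energy over moments. -/

section ExponentialFamily

open ProbabilityTheory

variable {X κ : Type*} [MeasurableSpace X] [Fintype κ] {γ : Measure X} {T : X → κ → ℝ}

theorem integrable_exp_dotProduct_tilted
    (hexp : ∀ η : κ → ℝ, Integrable (fun x => Real.exp (η ⬝ᵥ T x)) γ) (η c : κ → ℝ) :
    Integrable (fun x => Real.exp (c ⬝ᵥ T x)) (γ.tilted fun x => η ⬝ᵥ T x) := by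
  rw [integrable_tilted_iff (hexp η)]
  simpa only [smul_eq_mul, ← Real.exp_add, ← add_dotProduct] using hexp (η + c)

theorem integrableExpSet_dotProduct_tilted
    (hexp : ∀ η : κ → ℝ, Integrable (fun x => Real.exp (η ⬝ᵥ T x)) γ) (η c : κ → ℝ) :
    integrableExpSet (fun x => c ⬝ᵥ T x) (γ.tilted fun x => η ⬝ᵥ T x) = Set.univ := by
  refine Set.eq_univ_of_forall fun t => ?_
  have := integrable_exp_dotProduct_tilted hexp η (t • c)
  simp only [smul_dotProduct, smul_eq_mul] at this
  exact this

theorem integrable_dotProduct_tilted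
    (hexp : ∀ η : κ → ℝ, Integrable (fun x => Real.exp (η ⬝ᵥ T x)) γ) (η c : κ → ℝ) :
    Integrable (fun x => c ⬝ᵥ T x) (γ.tilted fun x => η ⬝ᵥ T x) := by
  have h := integrable_pow_of_mem_interior_integrableExpSet
    (X := fun x => c ⬝ᵥ T x) (μ := γ.tilted fun x => η ⬝ᵥ T x)
    (by simp [integrableExpSet_dotProduct_tilted hexp]) 1
  simpa using h

theorem integrable_apply_tilted
    (hexp : ∀ η : κ → ℝ, Integrable (fun x => Real.exp (η ⬝ᵥ T x)) γ) (η : κ → ℝ) (k : κ) :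
    Integrable (fun x => T x k) (γ.tilted fun x => η ⬝ᵥ T x) := by
  classical
  simpa using integrable_dotProduct_tilted hexp η (Pi.single k 1)

/-- The logarithm of the partition function of the exponential family generated by `T`. -/
def logPartition (γ : Measure X) (T : X → κ → ℝ) (η : κ → ℝ) : ℝ :=
  Real.log (∫ x, Real.exp (η ⬝ᵥ T x) ∂γ)

/-- The vector of moments of `T` with respect to a member of its exponential family. -/
def tiltedMoment (γ : Measure X) (T : X → κ → ℝ) (η : κ → ℝ) (k : κ) : ℝ :=
  ∫ x, T x k ∂(γ.tilted fun x => η ⬝ᵥ T x)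

theorem integral_dotProduct_tilted
    (hexp : ∀ η : κ → ℝ, Integrable (fun x => Real.exp (η ⬝ᵥ T x)) γ) (η c : κ → ℝ) :
    ∫ x, c ⬝ᵥ T x ∂(γ.tilted fun x => η ⬝ᵥ T x) = c ⬝ᵥ tiltedMoment γ T η := by
  have h := integral_finsetSum Finset.univ
    fun k _ => (integrable_apply_tilted hexp η k).const_mul (c k)
  simp only [integral_const_mul] at h
  exact h

theorem log_integral_exp_tilted [NeZero γ]
    (hexp : ∀ η : κ → ℝ, Integrable (fun x => Real.exp (η ⬝ᵥ T x)) γ) (η c : κ → ℝ) :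
    Real.log (∫ x, Real.exp (c ⬝ᵥ T x) ∂(γ.tilted fun x => η ⬝ᵥ T x)) =
      logPartition γ T (η + c) - logPartition γ T η := by
  rw [integral_exp_tilted, Real.log_div]
  · simp [logPartition, add_dotProduct]
  · simpa only [Pi.add_apply, add_dotProduct] using (integral_exp_pos (hexp (η + c))).ne'
  · exact (integral_exp_pos (hexp η)).ne'

/-- Jensen's inequality for `exp` under the tilted measure. It says that the Legendre transform of
`logPartition` at the moments of the `η`-tilt is attained at `η`. -/
theorem dotProduct_tiltedMoment_sub_logPartition_le [NeZero γ]
    (hexp : ∀ η : κ → ℝ, Integrable (fun x => Real.exp (η ⬝ᵥ T x)) γ) (η η' : κ → ℝ) :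
    η' ⬝ᵥ tiltedMoment γ T η - logPartition γ T η' ≤
      η ⬝ᵥ tiltedMoment γ T η - logPartition γ T η := by
  have := isProbabilityMeasure_tilted (hexp η)
  have h := convexOn_exp.map_integral_le Real.continuous_exp.continuousOn isClosed_univ
    (by simp) (integrable_dotProduct_tilted hexp η (η' - η))
    (integrable_exp_dotProduct_tilted hexp η (η' - η))
  rw [integral_dotProduct_tilted hexp] at h
  have h2 := Real.log_le_log (Real.exp_pos _) h
  rw [Real.log_exp, log_integral_exp_tilted hexp, sub_dotProduct] at h2
  simp only [add_sub_cancel] at h2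
  linarith

/-- First-order condition: at a maximiser of `η' ⬝ᵥ m - logPartition γ T η'`, the gradient of
`logPartition`, which is the moment vector, equals `m`. -/
theorem eq_tiltedMoment_of_forall_le [NeZero γ]
    (hexp : ∀ η : κ → ℝ, Integrable (fun x => Real.exp (η ⬝ᵥ T x)) γ) (η m : κ → ℝ)
    (h : ∀ η', η' ⬝ᵥ m - logPartition γ T η' ≤ η ⬝ᵥ m - logPartition γ T η) :
    tiltedMoment γ T η = m := by
  classical
  have := isProbabilityMeasure_tilted (hexp η)
  funext k
  set c : κ → ℝ := Pi.single k 1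
  have hd := hasDerivAt_mgf (X := fun x => c ⬝ᵥ T x) (μ := γ.tilted fun x => η ⬝ᵥ T x) (t := 0)
    (by simp [integrableExpSet_dotProduct_tilted hexp])
  have hd2 : HasDerivAt (fun t : ℝ => Real.exp (t * m k)) (m k) 0 := by
    have := ((hasDerivAt_id (0 : ℝ)).mul_const (m k)).exp
    simpa using this
  -- Exponentiated optimality along the `k`-th axis: the moment generating function lies above `exp
  -- (t * m k)`, and both equal 1 at `t = 0`.
  have hmin : IsLocalMin (fun t => mgf (fun x => c ⬝ᵥ T x) (γ.tilted fun x => η ⬝ᵥ T x) t -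
      Real.exp (t * m k)) 0 := by
    refine Eventually.of_forall fun t => ?_
    have h1 := h (η + t • c)
    have h2 := log_integral_exp_tilted hexp η (t • c)
    have h3 : t * m k ≤
        Real.log (∫ x, Real.exp ((t • c) ⬝ᵥ T x) ∂(γ.tilted fun x => η ⬝ᵥ T x)) := by
      rw [h2]
      simp only [add_dotProduct, smul_dotProduct, smul_eq_mul, c, single_one_dotProduct] at h1 ⊢
      linarith
    rw [Real.le_log_iff_exp_le
      (integral_exp_pos (integrable_exp_dotProduct_tilted hexp η (t • c)))] at h3
    simpa [mgf, smul_dotProduct] using h3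
  have := hmin.hasDerivAt_eq_zero (hd.sub hd2)
  simp [c] at this
  rw [tiltedMoment]
  linarith

theorem tiltedMoment_mem_pairingCone
    (hexp : ∀ η : κ → ℝ, Integrable (fun x => Real.exp (η ⬝ᵥ T x)) γ) (ε η : κ → ℝ) :
    tiltedMoment γ T η ∈ pairingCone T ε := by
  intro b hb
  rw [← integral_dotProduct_tilted hexp]
  exact integral_nonneg hb

/-- The moments in the pairing cone at which the free energy is at most `c`. -/
def freeEnergySublevel (γ : Measure X) (T : X → κ → ℝ) (ε : κ → ℝ) (c : ℝ) : Set (κ → ℝ) :=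
  {m | m ∈ pairingCone T ε ∧
    ∀ η, η ⬝ᵥ m - logPartition γ T η + (ε * m) ⬝ᵥ m / 2 ≤ c}

/-- Testing with `η = ± e_k` bounds `± m k`, because the quadratic term is nonnegative on the cone.
-/
theorem isCompact_freeEnergySublevel {ε : κ → ℝ} (hpos : ∀ x y, 0 ≤ (ε * T x) ⬝ᵥ T y) (c : ℝ) :
    IsCompact (freeEnergySublevel γ T ε c) := by
  classical
  refine Metric.isCompact_of_isClosed_isBounded ?_ ?_
  · have h : freeEnergySublevel γ T ε c = pairingCone T ε ∩
        ⋂ η, {m | η ⬝ᵥ m - logPartition γ T η + (ε * m) ⬝ᵥ m / 2 ≤ c} := by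
      ext; simp [freeEnergySublevel]
    rw [h]
    refine (isClosed_pairingCone T ε).inter (isClosed_iInter fun b => ?_)
    exact isClosed_le (by unfold dotProduct; simp only [Pi.mul_apply]; fun_prop) continuous_const
  · refine (Metric.isBounded_Icc
      (fun k => -(logPartition γ T (Pi.single k (-1)) + c))
      (fun k => logPartition γ T (Pi.single k 1) + c)).subset ?_
    rintro m ⟨hm, hc⟩
    have h0 := pairing_self_nonneg hpos hm
    constructor <;> intro k
    · have := hc (Pi.single k (-1))
      rw [single_dotProduct] at this
      linarith
    · have := hc (Pi.single k 1)
      rw [single_dotProduct] at this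
      linarith

/-- Stating the minimum through sublevel sets avoids handling a supremum that may be infinite. -/
theorem exists_min_freeEnergy [NeZero γ] {ε : κ → ℝ}
    (hexp : ∀ η : κ → ℝ, Integrable (fun x => Real.exp (η ⬝ᵥ T x)) γ)
    (hpos : ∀ x y, 0 ≤ (ε * T x) ⬝ᵥ T y) :
    ∃ c, (freeEnergySublevel γ T ε c).Nonempty ∧
      ∀ c', (freeEnergySublevel γ T ε c').Nonempty → c ≤ c' := by
  set S : Set ℝ := {c | (freeEnergySublevel γ T ε c).Nonempty}
  have hne : S.Nonempty := by
    refine ⟨0 ⬝ᵥ tiltedMoment γ T 0 - logPartition γ T 0 +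
      (ε * tiltedMoment γ T 0) ⬝ᵥ tiltedMoment γ T 0 / 2, tiltedMoment γ T 0,
      tiltedMoment_mem_pairingCone hexp ε 0, fun η => ?_⟩
    exact add_le_add_left (dotProduct_tiltedMoment_sub_logPartition_le hexp 0 η) _
  have hbdd : BddBelow S := by
    refine ⟨-logPartition γ T 0, ?_⟩
    rintro c ⟨m, hm, hc⟩
    have := hc 0
    have h0 := pairing_self_nonneg hpos hm
    rw [zero_dotProduct] at this
    linarith
  refine ⟨sInf S, ?_, fun c' hc' => csInf_le hbdd hc'⟩
  have hmono : ∀ {a b : ℝ}, a ≤ b → freeEnergySublevel γ T ε a ⊆ freeEnergySublevel γ T ε b :=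
    fun hab m hm => ⟨hm.1, fun η => (hm.2 η).trans hab⟩
  -- The sublevels at `sInf S + 1 / (n + 1)` are nested, compact and nonempty; a common point
  -- attains the infimum.
  have hI := IsCompact.nonempty_iInter_of_sequence_nonempty_isCompact_isClosed
    (fun n : ℕ => freeEnergySublevel γ T ε (sInf S + 1 / ((n : ℝ) + 1)))
    (fun n => hmono (by
      push_cast
      gcongr
      linarith))
    (fun n => by
      obtain ⟨c, hc, hlt⟩ := exists_lt_of_csInf_lt hne
        (show sInf S < sInf S + 1 / ((n : ℝ) + 1) by
          have : 0 < 1 / ((n : ℝ) + 1) := by positivity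
          linarith)
      exact hc.mono (hmono hlt.le))
    (isCompact_freeEnergySublevel hpos _)
    (fun n => (isCompact_freeEnergySublevel hpos _).isClosed)
  obtain ⟨m, hm⟩ := hI
  rw [Set.mem_iInter] at hm
  refine ⟨m, (hm 0).1, fun η => ?_⟩
  have hlim : Tendsto (fun n : ℕ => sInf S + 1 / ((n : ℝ) + 1)) atTop (𝓝 (sInf S + 0)) :=
    tendsto_const_nhds.add tendsto_one_div_add_atTop_nhds_zero_nat
  rw [add_zero] at hlim
  exact ge_of_tendsto' hlim fun n => (hm n).2 η

/-- Existence of self-consistent moments: a vector `m` equal to the moments of `T` with respect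
to the Gibbs measure with energy `∑ k, ε k * m k * T k`. -/
theorem exists_tiltedMoment_eq [NeZero γ] {ε : κ → ℝ}
    (hexp : ∀ η : κ → ℝ, Integrable (fun x => Real.exp (η ⬝ᵥ T x)) γ)
    (hpos : ∀ x y, 0 ≤ (ε * T x) ⬝ᵥ T y) :
    ∃ m, tiltedMoment γ T (-(ε * m)) = m := by
  obtain ⟨c, ⟨m, hm, hc⟩, hmin⟩ := exists_min_freeEnergy hexp hpos
  refine ⟨m, eq_tiltedMoment_of_forall_le hexp _ _ ?_⟩
  set ζ := -(ε * m) with hζ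
  set m' := tiltedMoment γ T ζ with hm'
  set L := ζ ⬝ᵥ m' - logPartition γ T ζ with hL
  -- Compare `m` with the point `(1 - t) m + t m'` of the cone: the Legendre transform is convex and
  -- equals `L` at `m'`. The quadratic part need not be convex, since its second-order term carries
  -- a factor `t` after division by `t`.
  have hsub : ∀ t : ℝ, 0 < t → t ≤ 1 →
      c - (ε * m) ⬝ᵥ m / 2 ≤
        L + (ε * m) ⬝ᵥ (m' - m) + t * ((ε * (m' - m)) ⬝ᵥ (m' - m) / 2) := by
    intro t ht ht1
    have hq : (ε * ((1 - t) • m + t • m')) ⬝ᵥ ((1 - t) • m + t • m') =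
        (ε * m) ⬝ᵥ m + 2 * t * (ε * m) ⬝ᵥ (m' - m) +
          t ^ 2 * (ε * (m' - m)) ⬝ᵥ (m' - m) := by
      simp only [dotProduct, Finset.mul_sum, ← Finset.sum_add_distrib]
      refine Finset.sum_congr rfl fun k _ => ?_
      simp only [Pi.mul_apply, Pi.add_apply, Pi.smul_apply, Pi.sub_apply, smul_eq_mul]
      ring
    have := hmin ((1 - t) * (c - (ε * m) ⬝ᵥ m / 2) + t * L +
        (ε * ((1 - t) • m + t • m')) ⬝ᵥ ((1 - t) • m + t • m') / 2)
      ⟨_, combo_mem_pairingCone hm (tiltedMoment_mem_pairingCone hexp ε ζ) ht.le ht1, fun η => by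
        have h1 := mul_le_mul_of_nonneg_left (hc η) (sub_nonneg.2 ht1)
        have h2 := mul_le_mul_of_nonneg_left
          (dotProduct_tiltedMoment_sub_logPartition_le hexp ζ η) ht.le
        rw [← hm', ← hL] at h2
        rw [dotProduct_add, dotProduct_smul, dotProduct_smul]
        simp only [smul_eq_mul]
        linarith⟩
    rw [hq] at this
    refine le_of_mul_le_mul_left ?_ ht
    linarith
  have hlim : Tendsto (fun t : ℝ => L + (ε * m) ⬝ᵥ (m' - m) +
      t * ((ε * (m' - m)) ⬝ᵥ (m' - m) / 2)) (𝓝[>] 0)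
      (𝓝 (L + (ε * m) ⬝ᵥ (m' - m) + 0 * ((ε * (m' - m)) ⬝ᵥ (m' - m) / 2))) :=
    (Continuous.tendsto (by fun_prop) 0).mono_left nhdsWithin_le_nhds
  have hle := ge_of_tendsto hlim (by
    filter_upwards [Ioc_mem_nhdsGT (zero_lt_one' ℝ)] with t ht using hsub t ht.1 ht.2)
  -- With `ζ = -(ε * m)`, the limit `t → 0` reads `c - (ε * m) ⬝ᵥ m / 2 ≤ ζ ⬝ᵥ m - logPartition γ T
  -- ζ`. As `hc` bounds every competitor `η` by the left side, `ζ` is a maximiser.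
  intro η
  have h1 := hc η
  have h2 : ζ ⬝ᵥ m = -((ε * m) ⬝ᵥ m) := by rw [hζ, neg_dotProduct]
  have h3 : ζ ⬝ᵥ m' = -((ε * m) ⬝ᵥ m') := by rw [hζ, neg_dotProduct]
  rw [dotProduct_sub] at hle
  linarith

end ExponentialFamily

/-! ### Smooth functions of polynomial growth. -/

section Growth

variable {d : ℕ}

/-- Smooth functions growing at most like `|x| ^ p`. -/
def HasGrowth (p : ℕ) (u : Pos d → ℝ) : Prop :=
  ContDiff ℝ ∞ u ∧ ∃ C : ℝ, 0 ≤ C ∧ ∀ x, |u x| ≤ C * (1 + ‖x‖) ^ p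

theorem HasGrowth.mono {p q : ℕ} (hpq : p ≤ q) {u : Pos d → ℝ} (hu : HasGrowth p u) :
    HasGrowth q u := by
  obtain ⟨hs, C, hC, h⟩ := hu
  exact ⟨hs, C, hC, fun x => (h x).trans (mul_le_mul_of_nonneg_left
    (pow_le_pow_right₀ (by linarith [norm_nonneg x]) hpq) hC)⟩

theorem HasGrowth.add {p : ℕ} {u v : Pos d → ℝ} (hu : HasGrowth p u) (hv : HasGrowth p v) :
    HasGrowth p (fun x => u x + v x) := by
  obtain ⟨hs, C, hC, h⟩ := hu
  obtain ⟨hs', C', hC', h'⟩ := hv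
  refine ⟨hs.add hs', C + C', by positivity, fun x => (abs_add_le _ _).trans ?_⟩
  rw [add_mul]
  exact add_le_add (h x) (h' x)

theorem HasGrowth.mul {p q : ℕ} {u v : Pos d → ℝ} (hu : HasGrowth p u) (hv : HasGrowth q v) :
    HasGrowth (p + q) (fun x => u x * v x) := by
  obtain ⟨hs, C, hC, h⟩ := hu
  obtain ⟨hs', C', hC', h'⟩ := hv
  refine ⟨hs.mul hs', C * C', by positivity, fun x => ?_⟩
  rw [abs_mul, pow_add, mul_mul_mul_comm]
  exact mul_le_mul (h x) (h' x) (abs_nonneg _) ((abs_nonneg _).trans (h x))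

theorem hasGrowth_const (c : ℝ) : HasGrowth 0 (fun _ : Pos d => c) :=
  ⟨contDiff_const, |c|, abs_nonneg c, fun _ => by simp⟩

theorem HasGrowth.const_mul {p : ℕ} {u : Pos d → ℝ} (hu : HasGrowth p u) (c : ℝ) :
    HasGrowth p (fun x => c * u x) := by
  simpa using (hasGrowth_const c).mul hu

theorem HasGrowth.sum {p : ℕ} {ι : Type*} (s : Finset ι) {u : ι → Pos d → ℝ}
    (hu : ∀ i, HasGrowth p (u i)) : HasGrowth p (fun x => ∑ i ∈ s, u i x) := by
  classical
  induction s using Finset.induction_on with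
  | empty => simpa using (hasGrowth_const (d := d) 0).mono (Nat.zero_le p)
  | insert i s hi ih => simpa only [Finset.sum_insert hi] using (hu i).add ih

theorem HasGrowth.pow {p : ℕ} {u : Pos d → ℝ} (hu : HasGrowth p u) (k : ℕ) :
    HasGrowth (p * k) (fun x => u x ^ k) := by
  induction k with
  | zero => simpa using hasGrowth_const (d := d) 1
  | succ k ih => simpa only [pow_succ, Nat.mul_succ] using ih.mul hu

theorem HasGrowth.comp_neg {p : ℕ} {u : Pos d → ℝ} (hu : HasGrowth p u) :
    HasGrowth p (fun x => u (-x)) := by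
  obtain ⟨hs, C, hC, h⟩ := hu
  exact ⟨hs.comp contDiff_neg, C, hC, fun x => by simpa using h (-x)⟩

theorem hasGrowth_norm_sq : HasGrowth 2 (fun x : Pos d => ‖x‖ ^ 2) := by
  refine ⟨contDiff_norm_sq ℝ, 1, zero_le_one, fun x => ?_⟩
  rw [abs_of_nonneg (by positivity), one_mul]
  exact pow_le_pow_left₀ (norm_nonneg x) (by linarith) 2

theorem hasGrowth_coord (i : Fin d) : HasGrowth 1 (fun x : Pos d => x i) := by
  refine ⟨by fun_prop, 1, zero_le_one, fun x => ?_⟩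
  have := PiLp.norm_apply_le x i
  rw [Real.norm_eq_abs] at this
  linarith

end Growth

/-! ### Diagonal expansion of the interaction kernel. -/

section Kernel

variable {d : ℕ}

/-- The linear span of the kernels `u x * u y` with `u` growing at most like `|x| ^ p`. -/
def kernelSpan (d p : ℕ) : Submodule ℝ (Pos d → Pos d → ℝ) :=
  Submodule.span ℝ {k | ∃ u : Pos d → ℝ, HasGrowth p u ∧ k = fun x y => u x * u y}

theorem kernelSpan_mono {p q : ℕ} (h : p ≤ q) : kernelSpan d p ≤ kernelSpan d q := by
  refine Submodule.span_mono ?_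
  rintro _ ⟨u, hu, rfl⟩
  exact ⟨u, hu.mono h, rfl⟩

theorem mul_mem_kernelSpan {p q : ℕ} {k l : Pos d → Pos d → ℝ} (hk : k ∈ kernelSpan d p)
    (hl : l ∈ kernelSpan d q) : k * l ∈ kernelSpan d (p + q) := by
  have h := Submodule.mul_mem_mul hk hl
  rw [kernelSpan, kernelSpan, Submodule.span_mul_span] at h
  refine Submodule.span_mono ?_ h
  rintro _ ⟨_, ⟨u, hu, rfl⟩, _, ⟨v, hv, rfl⟩, rfl⟩
  refine ⟨_, hu.mul hv, ?_⟩
  funext x y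
  simp only [Pi.mul_apply]
  ring

theorem tensor_self_mem_kernelSpan {p : ℕ} {u : Pos d → ℝ} (hu : HasGrowth p u) :
    (fun x y => u x * u y) ∈ kernelSpan d p :=
  Submodule.subset_span ⟨u, hu, rfl⟩

/-- Polarisation through the squares of `u + v` and `u - v`; this brings in negative coefficients.
-/
theorem tensor_symm_mem_kernelSpan {p : ℕ} {u v : Pos d → ℝ} (hu : HasGrowth p u)
    (hv : HasGrowth p v) : (fun x y => u x * v y + v x * u y) ∈ kernelSpan d p := by
  have h := Submodule.sub_mem _
    (Submodule.smul_mem _ (1 / 2 : ℝ) (tensor_self_mem_kernelSpan (hu.add hv)))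
    (Submodule.smul_mem _ (1 / 2 : ℝ) (tensor_self_mem_kernelSpan (hu.add (hv.const_mul (-1)))))
  convert h using 1
  funext x y
  simp only [Pi.sub_apply, Pi.smul_apply, smul_eq_mul]
  ring

theorem inner_mem_kernelSpan : (fun x y : Pos d => inner ℝ x y) ∈ kernelSpan d 1 := by
  have h := Submodule.sum_mem (kernelSpan d 1) (t := Finset.univ)
    fun i _ => tensor_self_mem_kernelSpan (hasGrowth_coord (d := d) i)
  convert h using 1
  funext x y
  rw [Finset.sum_apply, Finset.sum_apply, PiLp.inner_apply]
  exact Finset.sum_congr rfl fun i _ => by simp [mul_comm]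

/-- Removing the two pure powers leaves mixed terms, whose factors have degree at most `2 * k + 1`,
one less than the total degree. This gain lets `V + ψ` dominate the factors. -/
theorem norm_sub_pow_sub_mem_kernelSpan (k : ℕ) :
    (fun x y : Pos d => (‖x - y‖ ^ 2) ^ (k + 1) - (‖x‖ ^ 2) ^ (k + 1) - (‖y‖ ^ 2) ^ (k + 1)) ∈
      kernelSpan d (2 * k + 1) := by
  have hone : HasGrowth 0 (fun _ : Pos d => (1 : ℝ)) := hasGrowth_const 1
  have hdist : (fun x y : Pos d => ‖x - y‖ ^ 2) ∈ kernelSpan d 2 := by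
    have h := Submodule.sub_mem _
      (tensor_symm_mem_kernelSpan (hasGrowth_norm_sq (d := d)) (hone.mono (Nat.zero_le 2)))
      (Submodule.smul_mem _ (2 : ℝ)
        (kernelSpan_mono (show 1 ≤ 2 by norm_num) (inner_mem_kernelSpan (d := d))))
    convert h using 1
    funext x y
    simp only [Pi.sub_apply, Pi.smul_apply, smul_eq_mul, norm_sub_sq_real]
    ring
  induction k with
  | zero =>
    convert Submodule.smul_mem _ (-2 : ℝ) (inner_mem_kernelSpan (d := d)) using 1
    funext x y
    simp only [Pi.smul_apply, smul_eq_mul, norm_sub_sq_real]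
    ring
  | succ k ih =>
    have hpow := (hasGrowth_norm_sq (d := d)).pow (k + 1)
    have h1 := mul_mem_kernelSpan hdist ih
    have h2 := tensor_symm_mem_kernelSpan hpow
      ((hasGrowth_norm_sq (d := d)).mono (show 2 ≤ 2 * (k + 1) by lia))
    have h3 := mul_mem_kernelSpan (inner_mem_kernelSpan (d := d))
      (tensor_symm_mem_kernelSpan hpow (hone.mono (Nat.zero_le _)))
    have h := Submodule.sub_mem _ (Submodule.add_mem _
      (kernelSpan_mono (show 2 + (2 * k + 1) ≤ 2 * (k + 1) + 1 by lia) h1)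
      (kernelSpan_mono (show 2 * (k + 1) ≤ 2 * (k + 1) + 1 by lia) h2))
      (Submodule.smul_mem _ (2 : ℝ)
        (kernelSpan_mono (show 1 + 2 * (k + 1) ≤ 2 * (k + 1) + 1 by lia) h3))
    convert h using 1
    funext x y
    simp only [Pi.sub_apply, Pi.add_apply, Pi.mul_apply, Pi.smul_apply, smul_eq_mul,
      norm_sub_sq_real]
    ring

theorem radial_sub_mem_kernelSpan {g : Polynomial ℝ} {n : ℕ} (hn : g.natDegree ≤ n + 1)
    (h0 : g.coeff 0 = 0) :
    (fun x y : Pos d => g.eval (‖x - y‖ ^ 2) - g.eval (‖x‖ ^ 2) - g.eval (‖y‖ ^ 2)) ∈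
      kernelSpan d (2 * n + 1) := by
  have h := Submodule.sum_mem (kernelSpan d (2 * n + 1)) (t := Finset.range (n + 1))
    fun k hk => Submodule.smul_mem _ (g.coeff (k + 1)) (kernelSpan_mono
      (show 2 * k + 1 ≤ 2 * n + 1 by have := Finset.mem_range.1 hk; lia)
      (norm_sub_pow_sub_mem_kernelSpan (d := d) k))
  convert h using 1
  funext x y
  have heval : ∀ s : ℝ, g.eval s = ∑ k ∈ Finset.range (n + 1), g.coeff (k + 1) * s ^ (k + 1) := by
    intro s
    rw [Polynomial.eval_eq_sum_range' (show g.natDegree < n + 1 + 1 by lia),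
      Finset.sum_range_succ', h0]
    simp
  rw [Finset.sum_apply, Finset.sum_apply, heval, heval, heval, ← Finset.sum_sub_distrib,
    ← Finset.sum_sub_distrib]
  refine Finset.sum_congr rfl fun k _ => ?_
  simp only [Pi.smul_apply, smul_eq_mul]
  ring

theorem exists_diagonal_of_mem_kernelSpan {p : ℕ} {k : Pos d → Pos d → ℝ}
    (hk : k ∈ kernelSpan d p) :
    ∃ (N : ℕ) (c : Fin N → ℝ) (u : Fin N → Pos d → ℝ), (∀ i, HasGrowth p (u i)) ∧
      ∀ x y, k x y = ∑ i, c i * (u i x * u i y) := by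
  obtain ⟨N, c, s, rfl⟩ := Submodule.mem_span_set'.1 hk
  choose u hu hs using fun i => (s i).2
  refine ⟨N, c, u, hu, fun x y => ?_⟩
  rw [Finset.sum_apply, Finset.sum_apply]
  exact Finset.sum_congr rfl fun i _ => by simp [hs i]

end Kernel

/-! ### Convexity of the radial profile in the variable `|x|²`. -/

section Radial

open Polynomial

theorem exists_eval_sq_of_even {G : ℝ[X]} (hG : Function.Even fun r : ℝ => G.eval r) :
    ∃ g : ℝ[X], G = g.comp (X ^ 2) := by
  have hcomp : G.comp (C (-1) * X) = G := Polynomial.funext fun r => by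
    simpa using hG r
  have hodd : ∀ k, ¬ 2 ∣ k → G.coeff k = 0 := by
    intro k hk
    have h := congrArg (fun P : ℝ[X] => P.coeff k) hcomp
    have hk' : Odd k := Nat.not_even_iff_odd.1 fun h => hk h.two_dvd
    simp only [comp_C_mul_X_coeff, hk'.neg_one_pow] at h
    linarith
  refine ⟨G.contract 2, ?_⟩
  rw [← expand_eq_comp_X_pow]
  ext k
  rw [coeff_expand two_pos]
  split_ifs with h
  · rw [coeff_contract two_ne_zero, Nat.div_mul_cancel h]
  · exact hodd k h

/-- With `G r = g (r²)`, the even convex function `G''` is nondecreasing on `[0, ∞)`. As `G' 0 = 0`,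
the mean value theorem gives `G' r ≤ r * G'' r`, which is `0 ≤ 4 r³ g'' (r²)`. -/
theorem convexOn_of_comp_sq {g : ℝ[X]}
    (h : ConvexOn ℝ Set.univ fun r : ℝ => (g.comp (X ^ 2)).derivative.derivative.eval r) :
    ConvexOn ℝ (Set.Ici 0) fun s : ℝ => g.eval s := by
  set G := g.comp (X ^ 2)
  have hG1 : ∀ r, G.derivative.eval r = 2 * r * g.derivative.eval (r ^ 2) := by
    intro r; simp only [G, derivative_comp, eval_mul, eval_comp, derivative_X_pow, eval_pow, eval_X]; simp
  have hG2 : ∀ r, G.derivative.derivative.eval r =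
      2 * g.derivative.eval (r ^ 2) + 4 * r ^ 2 * g.derivative.derivative.eval (r ^ 2) := by
    intro r; simp [G, derivative_comp, derivative_mul]; ring
  have hmono : ∀ r s : ℝ, 0 ≤ r → r ≤ s →
      G.derivative.derivative.eval r ≤ G.derivative.derivative.eval s := by
    intro r s hr hrs
    have hm := h.le_max_of_mem_Icc (x := -s) (y := s) (z := r) trivial trivial
      ⟨by linarith, hrs⟩
    have he : G.derivative.derivative.eval (-s) = G.derivative.derivative.eval s := by
      rw [hG2, hG2, neg_sq]
    simpa [he] using hm
  have hle : ∀ r : ℝ, 0 < r → G.derivative.eval r ≤ r * G.derivative.derivative.eval r := by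
    intro r hr
    obtain ⟨ξ, hξ, hd⟩ := exists_hasDerivAt_eq_slope (fun r => G.derivative.eval r)
      (fun r => G.derivative.derivative.eval r) hr (by fun_prop)
      fun x _ => G.derivative.hasDerivAt x
    have h1 := hmono ξ r hξ.1.le hξ.2.le
    rw [hd, hG1 0] at h1
    simp only [mul_zero, zero_mul, sub_zero] at h1
    rwa [div_le_iff₀ hr, mul_comm] at h1
  have hnonneg : ∀ s : ℝ, 0 < s → 0 ≤ g.derivative.derivative.eval s := by
    intro s hs
    have h1 := hle (√s) (Real.sqrt_pos.2 hs)
    rw [hG1, hG2, Real.sq_sqrt hs.le] at h1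
    have h2 : 0 < √s * s := mul_pos (Real.sqrt_pos.2 hs) hs
    refine nonneg_of_mul_nonneg_right (a := 4 * (√s * s)) ?_ (by positivity)
    linarith
  refine convexOn_of_hasDerivWithinAt2_nonneg (convex_Ici 0)
    (f' := fun s => g.derivative.eval s) (f'' := fun s => g.derivative.derivative.eval s)
    (by fun_prop) (fun x _ => (g.hasDerivAt x).hasDerivWithinAt)
    (fun x _ => (g.derivative.hasDerivAt x).hasDerivWithinAt) ?_
  intro x hx
  rw [interior_Ici] at hx
  exact hnonneg x hx

/-- Both `f a` and `f b` lie below the chord from `0` to `a + b`. -/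
theorem add_le_of_convexOn_Ici {f : ℝ → ℝ} (hf : ConvexOn ℝ (Set.Ici 0) f) (h0 : f 0 = 0)
    {a b : ℝ} (ha : 0 ≤ a) (hb : 0 ≤ b) : f a + f b ≤ f (a + b) := by
  rcases (add_nonneg ha hb).eq_or_lt with hab | hab
  · have ha0 : a = 0 := by linarith
    have hb0 : b = 0 := by linarith
    simp [ha0, hb0, h0]
  have key : ∀ c, 0 ≤ c → c ≤ a + b → f c ≤ c / (a + b) * f (a + b) := by
    intro c hc hcab
    have := hf.2 (Set.mem_Ici.2 hab.le) (Set.mem_Ici.2 le_rfl)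
      (show 0 ≤ c / (a + b) by positivity) (sub_nonneg.2 ((div_le_one hab).2 hcab)) (add_sub_cancel _ _)
    simpa [h0, div_mul_cancel₀ _ hab.ne'] using this
  have h1 := key a ha (by linarith)
  have h2 := key b hb (by linarith)
  have h3 : a / (a + b) * f (a + b) + b / (a + b) * f (a + b) = f (a + b) := by
    field_simp
  linarith

/-- Superadditivity, then convexity at the midpoint `‖x‖² + ‖y‖²` of `‖x - y‖²` and `‖x + y‖²`
(parallelogram law). -/
theorem radial_symm_nonneg {d : ℕ} {f : ℝ → ℝ} (hf : ConvexOn ℝ (Set.Ici 0) f) (h0 : f 0 = 0)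
    (x y : Pos d) :
    f (‖x‖ ^ 2) + f (‖y‖ ^ 2) ≤ (f (‖x - y‖ ^ 2) + f (‖x + y‖ ^ 2)) / 2 := by
  refine (add_le_of_convexOn_Ici hf h0 (sq_nonneg _) (sq_nonneg _)).trans ?_
  have h := hf.2 (Set.mem_Ici.2 (sq_nonneg ‖x - y‖)) (Set.mem_Ici.2 (sq_nonneg ‖x + y‖))
    (show (0 : ℝ) ≤ 1 / 2 by norm_num) (show (0 : ℝ) ≤ 1 / 2 by norm_num) (by norm_num)
  simp only [smul_eq_mul] at h
  have he : 1 / 2 * ‖x - y‖ ^ 2 + 1 / 2 * ‖x + y‖ ^ 2 = ‖x‖ ^ 2 + ‖y‖ ^ 2 := by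
    rw [norm_sub_sq_real, norm_add_sq_real]; ring
  rw [he] at h
  linarith

end Radial

/-! ### Lower bounds for the potentials. -/

section Confinement

open Polynomial

/-- An even convex function is smallest at `0`, so `G ≥ 0`, which excludes the limit `-∞`. -/
theorem leadingCoeff_pos_of_even_convex {G : ℝ[X]} {n : ℕ}
    (heven : Function.Even fun r : ℝ => G.eval r) (hn : 1 ≤ n) (hdeg : G.natDegree = 2 * n)
    (hconv : ConvexOn ℝ Set.univ fun r : ℝ => G.eval r) (h0 : G.eval 0 = 0) :
    0 < G.leadingCoeff := by
  have hnonneg : ∀ r : ℝ, 0 ≤ G.eval r := by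
    intro r
    have h := hconv.le_max_of_mem_Icc (x := -|r|) (y := |r|) (z := 0) trivial trivial
      ⟨by simp, by simp⟩
    have he : G.eval (-|r|) = G.eval |r| := heven |r|
    have he' : G.eval |r| = G.eval r := by
      rcases abs_choice r with hr | hr
      · rw [hr]
      · rw [hr]; exact heven r
    simpa [he, he', h0] using h
  by_contra hle
  have hdeg' : 0 < G.degree := natDegree_pos_iff_degree_pos.1 (by lia)
  have hlim := G.tendsto_atBot_of_leadingCoeff_nonpos hdeg' (not_lt.1 hle)
  obtain ⟨r, hr⟩ := (hlim.eventually_lt_atBot 0).exists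
  exact absurd (hnonneg r) (not_le.2 hr)

theorem exists_growth_le_eval {G : ℝ[X]} {p : ℕ} (hdeg : p < G.natDegree)
    (hlead : 0 < G.leadingCoeff) (C : ℝ) :
    ∃ C', ∀ r : ℝ, 0 ≤ r → C * (1 + r) ^ p ≤ G.eval r + C' := by
  set Q : ℝ[X] := Polynomial.C C * (1 + X) ^ p
  have hQ : Q.degree < G.degree := by
    refine degree_lt_degree (lt_of_le_of_lt ?_ hdeg)
    refine (natDegree_C_mul_le _ _).trans ?_
    refine (natDegree_pow_le_of_le p (?_ : _ ≤ 1)).trans (by simp)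
    compute_degree
  have hdeg' : 0 < (G - Q).degree := by
    rw [degree_sub_eq_left_of_degree_lt hQ]
    exact natDegree_pos_iff_degree_pos.1 (by lia)
  have hlim := (G - Q).tendsto_atTop_of_leadingCoeff_nonneg hdeg'
    (by rw [leadingCoeff_sub_of_degree_lt hQ]; exact hlead.le)
  obtain ⟨M, hM⟩ := (hlim.eventually_ge_atTop 0).exists_forall_of_atTop
  obtain ⟨b, hb⟩ := (isCompact_Icc (a := (0 : ℝ)) (b := M)).bddBelow_image
    (f := fun r => (G - Q).eval r) (by fun_prop)
  refine ⟨|b|, fun r hr => ?_⟩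
  have hval : (G - Q).eval r = G.eval r - C * (1 + r) ^ p := by simp [Q]
  rcases le_total r M with h | h
  · have := hb ⟨r, ⟨hr, h⟩, rfl⟩
    simp only [hval] at this
    linarith [neg_abs_le b]
  · have := hM r h
    rw [hval] at this
    linarith [abs_nonneg b]

theorem exists_linear_le_quartic {a : ℝ} (ha : 0 < a) (b c : ℝ) :
    ∃ C', ∀ r : ℝ, c * r ≤ a * r ^ 4 - b * r ^ 2 + C' := by
  -- Two completed squares: one in `r ^ 2` that leaves a spare `r ^ 2`, which then absorbs `c * r`.
  refine ⟨(b + 1) ^ 2 / (4 * a) + c ^ 2 / 4, fun r => ?_⟩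
  have h1 : 0 ≤ a * (r ^ 2 - (b + 1) / (2 * a)) ^ 2 := by positivity
  have h2 : a * (r ^ 2 - (b + 1) / (2 * a)) ^ 2 =
      a * r ^ 4 - (b + 1) * r ^ 2 + (b + 1) ^ 2 / (4 * a) := by
    field_simp
    ring
  linarith [sq_nonneg (r - c / 2)]

end Confinement

/-! ### Integrability against Gibbs weights. -/

section Integrability

variable {d : ℕ} {V ψ : Pos d → ℝ} {p : ℕ}

/-- A potential dominating every function of growth at most `p`, up to a linear margin. -/
def Dominates (p : ℕ) (F : Pos d → ℝ) : Prop :=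
  ∀ c C : ℝ, ∃ C', ∀ x, C * (1 + ‖x‖) ^ p + c * ‖x‖ ≤ F x + C'

theorem Dominates.add {F W : Pos d → ℝ} (hF : Dominates p F) (hW : HasGrowth p W) :
    Dominates p (fun x => F x + W x) := by
  obtain ⟨_, A, hA, hWA⟩ := hW
  intro c C
  obtain ⟨C', hC'⟩ := hF c (C + A)
  refine ⟨C', fun x => ?_⟩
  have h1 := hC' x
  have h2 := neg_abs_le (W x)
  have h3 := hWA x
  rw [add_mul] at h1
  linarith

theorem Dominates.const_mul {F : Pos d → ℝ} (hF : Dominates p F) {a : ℝ} (ha : 0 < a) :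
    Dominates p (fun x => a * F x) := by
  intro c C
  obtain ⟨C', hC'⟩ := hF (c / a) (C / a)
  refine ⟨a * C', fun x => ?_⟩
  have h := mul_le_mul_of_nonneg_left (hC' x) ha.le
  have e : a * (C / a * (1 + ‖x‖) ^ p + c / a * ‖x‖) = C * (1 + ‖x‖) ^ p + c * ‖x‖ := by
    field_simp
  rw [e] at h
  linarith

theorem Dominates.bddBelow {F : Pos d → ℝ} (hF : Dominates p F) : ∃ b, ∀ x, b ≤ F x := by
  obtain ⟨C', hC'⟩ := hF 0 0
  exact ⟨-C', fun x => by linarith [hC' x]⟩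

theorem Dominates.integrable_mul_exp {F h : Pos d → ℝ} (hF : Dominates p F) (hFc : Continuous F)
    {q : ℕ} (hh : HasGrowth q h) : Integrable fun x => h x * Real.exp (-F x) := by
  obtain ⟨hs, A, hA, hhA⟩ := hh
  obtain ⟨C', hC'⟩ := hF 1 0
  -- The factor `exp (-(1 + ‖x‖))` from the linear margin must absorb `q` powers for `h` and `d + 1`
  -- more for an integrable tail.
  set k := q + (d + 1)
  set B := A * (k.factorial * Real.exp (1 + C'))
  have hint : Integrable fun x : Pos d => B * (1 + ‖x‖) ^ (-((d : ℝ) + 1)) :=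
    (integrable_one_add_norm (by simp)).const_mul B
  refine hint.mono' (hs.continuous.mul (by fun_prop)).aestronglyMeasurable
    (Eventually.of_forall fun x => ?_)
  have hx : 0 < 1 + ‖x‖ := by positivity
  have hexp : Real.exp (-F x) ≤ Real.exp (1 + C') * Real.exp (-(1 + ‖x‖)) := by
    rw [← Real.exp_add]
    exact Real.exp_le_exp.2 (by linarith [hC' x])
  have hpow : (1 + ‖x‖) ^ q * Real.exp (-(1 + ‖x‖)) ≤
      k.factorial * (1 + ‖x‖) ^ (-((d : ℝ) + 1)) := by
    have h1 := Real.pow_div_factorial_le_exp (1 + ‖x‖) hx.le k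
    rw [div_le_iff₀ (by positivity)] at h1
    have h2 : (1 + ‖x‖) ^ (-((d : ℝ) + 1)) = ((1 + ‖x‖) ^ (d + 1))⁻¹ := by
      rw [Real.rpow_neg hx.le, ← Real.rpow_natCast]
      push_cast
      rfl
    rw [h2, Real.exp_neg, ← div_eq_mul_inv, ← div_eq_mul_inv, div_le_div_iff₀ (by positivity)
      (by positivity), ← pow_add]
    linarith
  rw [Real.norm_eq_abs, abs_mul, Real.abs_exp]
  calc |h x| * Real.exp (-F x)
      ≤ (A * (1 + ‖x‖) ^ q) * (Real.exp (1 + C') * Real.exp (-(1 + ‖x‖))) :=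
        mul_le_mul (hhA x) hexp (Real.exp_pos _).le (by positivity)
    _ = A * Real.exp (1 + C') * ((1 + ‖x‖) ^ q * Real.exp (-(1 + ‖x‖))) := by ring
    _ ≤ A * Real.exp (1 + C') * (k.factorial * (1 + ‖x‖) ^ (-((d : ℝ) + 1))) := by gcongr
    _ = B * (1 + ‖x‖) ^ (-((d : ℝ) + 1)) := by ring

theorem ConfiningPotential.dominates {G : Polynomial ℝ} (hV : ConfiningPotential V)
    (hψ : ∀ x, ψ x = G.eval ‖x‖) (hp : p < G.natDegree) (hG : 0 < G.leadingCoeff) :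
    Dominates p (fun x => V x + ψ x) := by
  intro c C
  obtain ⟨C₄, C₂, h4, -, hle⟩ := hV.quartic_lower
  obtain ⟨A, hA⟩ := exists_growth_le_eval hp hG C
  obtain ⟨B, hB⟩ := exists_linear_le_quartic h4 C₂ c
  refine ⟨A + B, fun x => ?_⟩
  simp only [hψ]
  linarith [hA ‖x‖ (norm_nonneg x), hB ‖x‖, hle x]

end Integrability

/-! ### The self-consistent even potential. -/

section SelfConsistent

variable {d : ℕ}

/-- The data extracted from the interaction potential: it is smooth of polynomial growth, and
`ψ (x - y) - ψ x - ψ y` is a finite sum of products of functions of lower order, whose even part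
is nonnegative. -/
theorem InteractionPotential.exists_diagonal {ψ : Pos d → ℝ} (hψ : InteractionPotential ψ) :
    ∃ (p q N : ℕ) (c : Fin N → ℝ) (u : Fin N → Pos d → ℝ),
      (∀ V : Pos d → ℝ, ConfiningPotential V → Dominates p fun x => V x + ψ x) ∧
      HasGrowth q ψ ∧ (∀ i, HasGrowth p (u i)) ∧
      (∀ x y, ψ (x - y) - ψ x - ψ y = ∑ i, c i * (u i x * u i y)) ∧
      ∀ x y, ψ x + ψ y ≤ (ψ (x - y) + ψ (x + y)) / 2 := by
  obtain ⟨G, heven, hψG, ⟨n, hn, hdeg⟩, hconv, hconv2, h0⟩ := hψ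
  obtain ⟨g, hg⟩ := exists_eval_sq_of_even heven
  have hψg : ∀ x, ψ x = g.eval (‖x‖ ^ 2) := fun x => by rw [hψG, hg]; simp
  have hg0 : g.eval 0 = 0 := by rw [hg] at h0; simpa using h0
  have hgdeg : g.natDegree = n := by
    have := congrArg Polynomial.natDegree hg
    rw [hdeg, Polynomial.natDegree_comp, Polynomial.natDegree_X_pow] at this
    lia
  obtain ⟨m, rfl⟩ : ∃ m, n = m + 1 := ⟨n - 1, by lia⟩
  obtain ⟨N, c, u, hu, hk⟩ := exists_diagonal_of_mem_kernelSpan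
    (radial_sub_mem_kernelSpan (d := d) hgdeg.le (by rwa [Polynomial.coeff_zero_eq_eval_zero]))
  have hgc : ConvexOn ℝ (Set.Ici 0) fun s : ℝ => g.eval s :=
    convexOn_of_comp_sq (by rwa [← hg])
  refine ⟨2 * m + 1, 2 * (m + 1), N, c, u,
    fun V hV => hV.dominates hψG (by lia)
      (leadingCoeff_pos_of_even_convex heven hn hdeg hconv h0), ?_, hu,
    fun x y => by rw [hψg, hψg, hψg]; exact hk x y, fun x y => ?_⟩
  · have hsum := HasGrowth.sum (d := d) (p := 2 * (m + 1)) (Finset.range (g.natDegree + 1))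
      -- The cutoff gives every index the same growth bound; it is inactive on the range of
      -- summation.
      (u := fun k x => if k ≤ m + 1 then g.coeff k * (‖x‖ ^ 2) ^ k else 0) (fun k => by
        by_cases hk : k ≤ m + 1
        · simpa only [hk, if_true] using
            ((hasGrowth_norm_sq.pow k).const_mul (g.coeff k)).mono (by lia)
        · simpa only [hk, if_false] using (hasGrowth_const 0).mono (Nat.zero_le _))
    convert hsum using 1
    funext x
    rw [hψg, Polynomial.eval_eq_sum_range]
    refine Finset.sum_congr rfl fun k hk => ?_
    rw [if_pos (by have := Finset.mem_range.1 hk; lia)]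
  · simp only [hψg]
    exact radial_symm_nonneg hgc hg0 x y

theorem integral_mul_eq_of_even {h f : Pos d → ℝ} (hf : ∀ x, f (-x) = f x) :
    ∫ x, h (-x) * f x = ∫ x, h x * f x := by
  rw [← integral_neg_eq_self (fun x => h x * f x)]
  simp only [hf]

theorem gradient_eq_of_sub_eq_sum {ψ : Pos d → ℝ} {N : ℕ} {c : Fin N → ℝ}
    {u : Fin N → Pos d → ℝ} (hψ : Differentiable ℝ ψ) (hu : ∀ i, Differentiable ℝ (u i))
    (hk : ∀ x y, ψ (x - y) - ψ x - ψ y = ∑ i, c i * (u i x * u i y)) (q y : Pos d) :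
    gradient ψ (q - y) = gradient ψ q + ∑ i, (c i * u i y) • gradient (u i) q := by
  have h1 : HasFDerivAt (fun x => ψ (x - y)) (fderiv ℝ ψ (q - y)) q := by
    have h := (hψ (q - y)).hasFDerivAt.comp q ((hasFDerivAt_id q).sub_const y)
    rwa [ContinuousLinearMap.comp_id] at h
  have h2 : HasFDerivAt (fun x => ψ x + ∑ i, (c i * u i y) * u i x + ψ y)
      (fderiv ℝ ψ q + ∑ i, (c i * u i y) • fderiv ℝ (u i) q) q :=
    ((hψ q).hasFDerivAt.add (HasFDerivAt.fun_sum fun i _ =>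
      (hu i q).hasFDerivAt.const_mul (c i * u i y))).add_const _
  have he : (fun x => ψ (x - y)) = fun x => ψ x + ∑ i, (c i * u i y) * u i x + ψ y := by
    funext x
    have : ∑ i, (c i * u i y) * u i x = ∑ i, c i * (u i x * u i y) :=
      Finset.sum_congr rfl fun i _ => by ring
    rw [this, ← hk x y]
    ring
  rw [he] at h1
  simp only [gradient, h1.unique h2, map_add, map_sum, map_smul]

theorem exists_selfConsistent_potential {V ψ : Pos d → ℝ} (hV : ConfiningPotential V)
    (hψ : InteractionPotential ψ) (hVeven : Function.Even V) (hψeven : Function.Even ψ)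
    {lam : ℝ} (hlam : 0 < lam) :
    ∃ U : Pos d → ℝ, ContDiff ℝ ∞ U ∧ Function.Even U ∧ (∃ b, ∀ x, b ≤ U x) ∧
      Integrable (fun y => Real.exp (-U y / lam)) ∧
      (∀ q, Integrable fun y => Real.exp (-U y / lam) * ψ (q - y)) ∧
      (∀ q, Integrable fun y => Real.exp (-U y / lam) • gradient ψ (q - y)) ∧
      ∀ q, ∫ y, Real.exp (-U y / lam) • gradient ψ (q - y) =
        (∫ y, Real.exp (-U y / lam)) • (gradient U q - gradient V q) := by
  obtain ⟨p, r, N, c, u, hdom, hψg, hu, hk, hpos⟩ := hψ.exists_diagonal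
  have hdomV := hdom V hV
  have hcV : Continuous V := hV.smooth.continuous
  have hcψ : Continuous ψ := hψg.1.continuous
  set F : Pos d → ℝ := fun x => V x + ψ x
  set w : Fin N → Pos d → ℝ := fun i x => (u i x + u i (-x)) / 2
  have hw : ∀ i, HasGrowth p (w i) := fun i => by
    have := ((hu i).add (hu i).comp_neg).const_mul (1 / 2)
    convert this using 2
    ring
  -- Average the kernel identity over the four sign choices `(±x, ±y)`.
  have hwsum : ∀ x y, ∑ i, c i * (w i x * w i y) = (ψ (x - y) + ψ (x + y)) / 2 - ψ x - ψ y := by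
    intro x y
    have h1 := hk x y
    have h2 := hk (-x) y
    have h3 := hk x (-y)
    have h4 := hk (-x) (-y)
    rw [show -x - y = -(x + y) by abel, hψeven, hψeven] at h2
    rw [sub_neg_eq_add, hψeven] at h3
    rw [show -x - -y = -(x - y) by abel, hψeven, hψeven, hψeven] at h4
    have : ∑ i, c i * (w i x * w i y) = (∑ i, c i * (u i x * u i y) +
        ∑ i, c i * (u i (-x) * u i y) + ∑ i, c i * (u i x * u i (-y)) +
        ∑ i, c i * (u i (-x) * u i (-y))) / 4 := by
      simp only [← Finset.sum_add_distrib, Finset.sum_div]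
      exact Finset.sum_congr rfl fun i _ => by simp only [w]; ring
    rw [this, ← h1, ← h2, ← h3, ← h4]
    ring
  set T : Pos d → Fin N → ℝ := fun x i => w i x
  set ε : Fin N → ℝ := fun i => c i / lam
  have hgrow : ∀ η : Fin N → ℝ, HasGrowth p fun x => η ⬝ᵥ T x := fun η =>
    HasGrowth.sum Finset.univ fun i => (hw i).const_mul (η i)
  have hdomF : Dominates p fun x => lam⁻¹ * F x := hdomV.const_mul (inv_pos.2 hlam)
  have hint0 : Integrable fun x => Real.exp (-(lam⁻¹ * F x)) := by
    simpa using hdomF.integrable_mul_exp (by fun_prop) (hasGrowth_const 1)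
  have hprob := isProbabilityMeasure_tilted hint0
  set γ : Measure (Pos d) := volume.tilted fun x => -(lam⁻¹ * F x)
  have hexp : ∀ η : Fin N → ℝ, Integrable (fun x => Real.exp (η ⬝ᵥ T x)) γ := by
    intro η
    rw [integrable_tilted_iff hint0]
    have h := (hdomF.add (hgrow (-η))).integrable_mul_exp
      (by have := (hgrow (-η)).1.continuous; fun_prop) (hasGrowth_const 1)
    refine h.congr (Eventually.of_forall fun x => ?_)
    simp only [one_mul, smul_eq_mul, ← Real.exp_add, neg_dotProduct]
    congr 1
    ring
  obtain ⟨m, hm⟩ := exists_tiltedMoment_eq (γ := γ) (T := T) (ε := ε) hexp (fun x y => by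
    have h : (ε * T x) ⬝ᵥ T y = (∑ i, c i * (w i x * w i y)) / lam := by
      simp only [dotProduct, Finset.sum_div, ε, T, Pi.mul_apply]
      exact Finset.sum_congr rfl fun i _ => by ring
    rw [h, hwsum]
    have := hpos x y
    exact div_nonneg (by linarith) hlam.le)
  set W : Pos d → ℝ := fun x => ∑ i, (c i * m i) * w i x
  have hW : HasGrowth p W := HasGrowth.sum Finset.univ fun i => (hw i).const_mul (c i * m i)
  set U : Pos d → ℝ := fun x => F x + W x
  have hUs : ContDiff ℝ ∞ U := (hV.smooth.add hψg.1).add hW.1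
  have hUeven : Function.Even U := by
    intro x
    simp only [U, F, W, w, hVeven x, hψeven x, neg_neg]
    congr 1
    exact Finset.sum_congr rfl fun i _ => by ring
  have hdomU : Dominates p U := hdomV.add hW
  have hdomU' : Dominates p fun x => lam⁻¹ * U x := hdomU.const_mul (inv_pos.2 hlam)
  have hcU : Continuous U := hUs.continuous
  have hexpU : ∀ x, Real.exp (-(lam⁻¹ * U x)) = Real.exp (-U x / lam) := fun x => by
    congr 1; ring
  have hint : ∀ {k : ℕ} {h : Pos d → ℝ}, HasGrowth k h →
      Integrable fun x => h x * Real.exp (-U x / lam) := by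
    intro k h hh
    simpa only [hexpU] using hdomU'.integrable_mul_exp (by fun_prop) hh
  have hintU : Integrable fun x => Real.exp (-U x / lam) := by
    simpa using hint (hasGrowth_const 1)
  set Z := ∫ y, Real.exp (-U y / lam)
  have hZ : 0 < Z := integral_exp_pos hintU
  have heven : ∀ x, Real.exp (-U (-x) / lam) = Real.exp (-U x / lam) := fun x => by rw [hUeven]
  -- The tilt of `γ` by `-(ε * m)` is the Gibbs measure of `U`, so the fixed-point equation gives
  -- its moments.
  have hmw : ∀ i, ∫ x, w i x * Real.exp (-U x / lam) = Z * m i := by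
    intro i
    have h := congrFun hm i
    rw [tiltedMoment, tilted_tilted hint0, integral_tilted] at h
    have he : ∀ x, ((fun x => -(lam⁻¹ * F x)) + fun x => -(ε * m) ⬝ᵥ T x) x = -U x / lam := by
      intro x
      have h1 : (ε * m) ⬝ᵥ T x = W x / lam := by
        simp only [dotProduct, W, ε, T, Pi.mul_apply, Finset.sum_div]
        exact Finset.sum_congr rfl fun i _ => by ring
      simp only [Pi.add_apply, neg_dotProduct, h1, U]
      ring
    simp only [he] at h
    change ∫ x, (Real.exp (-U x / lam) / Z) • w i x = m i at h
    rw [← h, ← integral_const_mul]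
    refine integral_congr_ae (Eventually.of_forall fun x => ?_)
    change w i x * Real.exp (-U x / lam) = Z * (Real.exp (-U x / lam) / Z * w i x)
    generalize Real.exp (-U x / lam) = e
    field_simp
  -- The weight is even, so `u i` and its even part have the same integral.
  have hmu : ∀ i, ∫ x, u i x * Real.exp (-U x / lam) = Z * m i := by
    intro i
    have h := integral_mul_eq_of_even (h := u i) (f := fun x => Real.exp (-U x / lam)) heven
    have h2 := hmw i
    have h3 : ∀ x, w i x * Real.exp (-U x / lam) = (1 / 2) * (u i x * Real.exp (-U x / lam)) +
        (1 / 2) * (u i (-x) * Real.exp (-U x / lam)) := fun x => by simp only [w]; ring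
    simp only [h3] at h2
    rw [integral_add ((hint (hu i)).const_mul _) ((hint (hu i).comp_neg).const_mul _),
      integral_const_mul, integral_const_mul, h] at h2
    linarith
  have hNW : ∀ x, Z * ∑ i, c i * m i * u i x =
      ∫ y, (ψ (x - y) - ψ x - ψ y) * Real.exp (-U y / lam) := by
    intro x
    have h : ∀ y, (ψ (x - y) - ψ x - ψ y) * Real.exp (-U y / lam) =
        ∑ i, (c i * u i x) * (u i y * Real.exp (-U y / lam)) := by
      intro y
      rw [hk, Finset.sum_mul]
      exact Finset.sum_congr rfl fun i _ => by ring
    simp only [h]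
    rw [integral_finsetSum _ fun i _ => (hint (hu i)).const_mul _, Finset.mul_sum]
    refine Finset.sum_congr rfl fun i _ => ?_
    rw [integral_const_mul, hmu]
    ring
  -- The single `u i` need not be even, but this combination is: by `hNW` it is an integral of an
  -- even kernel against an even weight.
  have hWu : W = fun x => ∑ i, c i * m i * u i x := by
    have hWeven : ∀ x, ∑ i, c i * m i * u i (-x) = ∑ i, c i * m i * u i x := by
      intro x
      refine mul_left_cancel₀ hZ.ne' ?_
      rw [hNW, hNW, ← integral_mul_eq_of_even (f := fun y => Real.exp (-U y / lam)) heven]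
      congr 1
      funext y
      rw [show -x - -y = -(x - y) by abel, hψeven, hψeven, hψeven]
    funext x
    have : W x = (∑ i, c i * m i * u i x + ∑ i, c i * m i * u i (-x)) / 2 := by
      rw [← Finset.sum_add_distrib, Finset.sum_div]
      exact Finset.sum_congr rfl fun i _ => by simp only [w]; ring
    rw [this, hWeven]
    ring
  have hdu : ∀ i, Differentiable ℝ (u i) := fun i => (hu i).1.differentiable (by simp)
  have hdψ : Differentiable ℝ ψ := hψg.1.differentiable (by simp)
  have hdV : Differentiable ℝ V := hV.smooth.differentiable (by simp)
  have hgrad : ∀ q y, Real.exp (-U y / lam) • gradient ψ (q - y) =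
      Real.exp (-U y / lam) • gradient ψ q +
        ∑ i, (u i y * Real.exp (-U y / lam)) • (c i • gradient (u i) q) := by
    intro q y
    rw [gradient_eq_of_sub_eq_sum hdψ hdu hk q y, smul_add, Finset.smul_sum]
    congr 1
    refine Finset.sum_congr rfl fun i _ => ?_
    rw [smul_smul, smul_smul]
    congr 1
    ring
  have hintgrad : ∀ q, ∀ i ∈ Finset.univ, Integrable fun y =>
      (u i y * Real.exp (-U y / lam)) • (c i • gradient (u i) q) :=
    fun q i _ => (hint (hu i)).smul_const _
  refine ⟨U, hUs, hUeven, hdomU.bddBelow, hintU, fun q => ?_, fun q => ?_, fun q => ?_⟩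
  · have h : ∀ y, Real.exp (-U y / lam) * ψ (q - y) = ψ q * Real.exp (-U y / lam) +
        ψ y * Real.exp (-U y / lam) + ∑ i, (c i * u i q) * (u i y * Real.exp (-U y / lam)) := by
      intro y
      have h1 : ∑ i, (c i * u i q) * (u i y * Real.exp (-U y / lam)) =
          (∑ i, c i * (u i q * u i y)) * Real.exp (-U y / lam) := by
        rw [Finset.sum_mul]
        exact Finset.sum_congr rfl fun i _ => by ring
      rw [h1, ← hk]
      ring
    simp only [h]
    exact ((hintU.const_mul _).add (hint hψg)).add
      (integrable_finsetSum _ fun i _ => (hint (hu i)).const_mul _)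
  · simp only [hgrad q]
    exact (hintU.smul_const _).add (integrable_finsetSum _ (hintgrad q))
  · simp only [hgrad q]
    rw [integral_add (hintU.smul_const _) (integrable_finsetSum _ (hintgrad q)),
      integral_finsetSum _ (hintgrad q), integral_smul_const]
    simp only [integral_smul_const, hmu]
    have hgU : gradient U q = gradient V q + gradient ψ q +
        ∑ i, (c i * m i) • gradient (u i) q := by
      have h2 : HasFDerivAt U (fderiv ℝ V q + fderiv ℝ ψ q +
          ∑ i, (c i * m i) • fderiv ℝ (u i) q) q := by
        simp only [U, F, hWu]
        exact ((hdV q).hasFDerivAt.add (hdψ q).hasFDerivAt).add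
          (HasFDerivAt.fun_sum fun i _ => (hdu i q).hasFDerivAt.const_mul (c i * m i))
      simp only [gradient, h2.fderiv, map_add, map_sum, map_smul]
    rw [hgU, add_sub_right_comm, add_sub_cancel_left, smul_add, Finset.smul_sum]
    congr 1
    refine Finset.sum_congr rfl fun i _ => ?_
    rw [smul_smul, smul_smul]
    congr 1
    ring

end SelfConsistent

/-! ### The Gaussian momentum factor and its derivatives. -/

section Maxwellian

variable {d : ℕ} {lam : ℝ}

/-- The unnormalised Maxwellian `exp (-|p|² / (2 lam))`. -/
def maxwellian (lam : ℝ) (p : Pos d) : ℝ :=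
  Real.exp (-((2 * lam)⁻¹ * ‖p‖ ^ 2))

theorem contDiff_maxwellian (lam : ℝ) : ContDiff ℝ ∞ (maxwellian lam : Pos d → ℝ) :=
  Real.contDiff_exp.comp (contDiff_const.mul (contDiff_norm_sq ℝ)).neg

theorem maxwellian_pos (lam : ℝ) (p : Pos d) : 0 < maxwellian lam p := Real.exp_pos _

theorem maxwellian_le_one (hlam : 0 < lam) (p : Pos d) : maxwellian lam p ≤ 1 :=
  Real.exp_le_one_iff.2 (neg_nonpos.2 (by positivity))

theorem integrable_maxwellian (hlam : 0 < lam) :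
    Integrable (maxwellian lam : Pos d → ℝ) := by
  have hdom : Dominates 0 fun x : Pos d => (2 * lam)⁻¹ * ‖x‖ ^ 2 := by
    intro c C
    refine ⟨C + c ^ 2 * lam / 2, fun x => ?_⟩
    have h : 0 ≤ (2 * lam)⁻¹ * (‖x‖ - c * lam) ^ 2 := by positivity
    have e : (2 * lam)⁻¹ * (‖x‖ - c * lam) ^ 2 =
        (2 * lam)⁻¹ * ‖x‖ ^ 2 - c * ‖x‖ + c ^ 2 * lam / 2 := by
      field_simp
      ring
    rw [e] at h
    linarith
  have h := hdom.integrable_mul_exp (by fun_prop) (hasGrowth_const 1)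
  simp only [one_mul] at h
  exact h

theorem hasFDerivAt_maxwellian (hlam : 0 < lam) (p : Pos d) :
    HasFDerivAt (maxwellian lam) ((-lam⁻¹ * maxwellian lam p) • innerSL ℝ p) p := by
  have h := (((hasStrictFDerivAt_norm_sq p).hasFDerivAt.const_mul (2 * lam)⁻¹).neg).exp
  have he : (-lam⁻¹ * maxwellian lam p) • innerSL ℝ p =
      Real.exp (-((2 * lam)⁻¹ * ‖p‖ ^ 2)) • -((2 * lam)⁻¹ • 2 • innerSL ℝ p) := by
    ext v
    simp [maxwellian]
    field_simp
  rw [he]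
  exact h

theorem laplacian_const_mul_maxwellian (hlam : 0 < lam) (c : ℝ) (p : Pos d) :
    Laplacian.laplacian (fun y : Pos d => c * maxwellian lam y) p =
      c * maxwellian lam p * (‖p‖ ^ 2 / lam ^ 2 - d / lam) := by
  set L : Pos d →L[ℝ] Pos d →L[ℝ] ℝ := innerSL ℝ
  have h1 : fderiv ℝ (fun y : Pos d => c * maxwellian lam y) =
      fun y => (c * (-lam⁻¹ * maxwellian lam y)) • L y := by
    funext y
    rw [((hasFDerivAt_maxwellian hlam y).const_mul c).fderiv, smul_smul]
  have h2 : fderiv ℝ (fun y : Pos d => (c * (-lam⁻¹ * maxwellian lam y)) • L y) p = _ :=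
    ((((hasFDerivAt_maxwellian hlam p).const_mul (-lam⁻¹)).const_mul c).smul
      (L.hasFDerivAt (x := p))).fderiv
  have h3 : ∀ v : Pos d, fderiv ℝ (fun y : Pos d => (c * (-lam⁻¹ * maxwellian lam y)) • L y) p v v =
      c * maxwellian lam p / lam ^ 2 * inner ℝ p v ^ 2 -
        c * maxwellian lam p / lam * inner ℝ v v := by
    intro v
    rw [h2]
    change c * (-lam⁻¹ * maxwellian lam p) * inner ℝ v v +
      c * (-lam⁻¹ * (-lam⁻¹ * maxwellian lam p * inner ℝ p v)) * inner ℝ p v = _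
    ring
  rw [InnerProductSpace.laplacian_eq_iteratedFDeriv_orthonormalBasis _
    (EuclideanSpace.basisFun (Fin d) ℝ)]
  simp only [iteratedFDeriv_two_apply, h1]
  refine (Finset.sum_congr rfl fun i _ => h3 (EuclideanSpace.basisFun (Fin d) ℝ i)).trans ?_
  rw [Finset.sum_sub_distrib, ← Finset.mul_sum, ← Finset.mul_sum,
    EuclideanSpace.real_norm_sq_eq]
  simp [EuclideanSpace.inner_single_right]
  ring

theorem divergence_smul_const {F : Pos d → ℝ} {q : Pos d} (hF : DifferentiableAt ℝ F q)
    (p : Pos d) : divergence (fun x => F x • p) q = fderiv ℝ F q p := by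
  have h : fderiv ℝ (fun x => F x • p) q = (fderiv ℝ F q).smulRight p :=
    (hF.hasFDerivAt.smul_const p).fderiv
  simp only [divergence, h]
  conv_rhs => rw [← (EuclideanSpace.basisFun (Fin d) ℝ).sum_repr p]
  simp [mul_comm]

theorem divergence_smul_const_add {F : Pos d → ℝ} {p : Pos d} (hF : DifferentiableAt ℝ F p)
    (w : Pos d) :
    divergence (fun y => F y • (w + y)) p = fderiv ℝ F p (w + p) + d * F p := by
  have h : fderiv ℝ (fun y => F y • (w + y)) p = _ :=
    (hF.hasFDerivAt.smul ((hasFDerivAt_id p).const_add w)).fderiv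
  have h3 := divergence_smul_const hF (w + p)
  have h4 : fderiv ℝ (fun x => F x • (w + p)) p = (fderiv ℝ F p).smulRight (w + p) :=
    (hF.hasFDerivAt.smul_const (w + p)).fderiv
  simp only [divergence, h4] at h3
  simp only [divergence]
  rw [h, ← h3]
  simp [Finset.sum_add_distrib, add_comm]

end Maxwellian

/-! ### The product density and its stationarity. -/

section Stationary

variable {d : ℕ} {V ψ U : Pos d → ℝ} {lam : ℝ}

/-- The density `(∫ exp (-U / lam))⁻¹ exp (-U q / lam)` of positions, times the Maxwellian. -/
def gibbsDensity (U : Pos d → ℝ) (lam : ℝ) (z : Phase d) : ℝ :=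
  ((∫ y, Real.exp (-U y / lam)) * ∫ y : Pos d, maxwellian lam y)⁻¹ * Real.exp (-U z.1 / lam) *
    maxwellian lam z.2

theorem integrable_maxwellian_smul {E : Type*} [NormedAddCommGroup E] [NormedSpace ℝ E]
    (hlam : 0 < lam) {F : Pos d → E} (hF : Integrable F) :
    Integrable fun z : Phase d => maxwellian lam z.2 • F z.1 :=
  ((integrable_maxwellian hlam).smul_prod hF).swap

theorem integral_maxwellian_smul {E : Type*} [NormedAddCommGroup E] [NormedSpace ℝ E]
    (F : Pos d → E) :
    ∫ z : Phase d, maxwellian lam z.2 • F z.1 =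
      (∫ y : Pos d, maxwellian lam y) • ∫ x, F x := by
  rw [← integral_prod_smul (μ := volume) (ν := volume), ← integral_prod_swap]
  rfl

theorem gibbsDensity_smul {E : Type*} [AddCommGroup E] [Module ℝ E] (F : Pos d → E)
    (z : Phase d) :
    gibbsDensity U lam z • F z.1 =
      maxwellian lam z.2 • ((((∫ y, Real.exp (-U y / lam)) * ∫ y : Pos d, maxwellian lam y)⁻¹ •
        (Real.exp (-U z.1 / lam) • F z.1))) := by
  simp only [gibbsDensity, smul_smul]
  congr 1
  ring

theorem integrable_gibbsDensity_smul {E : Type*} [NormedAddCommGroup E] [NormedSpace ℝ E]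
    (hlam : 0 < lam) {F : Pos d → E} (hF : Integrable fun x => Real.exp (-U x / lam) • F x) :
    Integrable fun z : Phase d => gibbsDensity U lam z • F z.1 := by
  simp only [gibbsDensity_smul]
  exact integrable_maxwellian_smul hlam (hF.smul _)

theorem integral_gibbsDensity_smul {E : Type*} [NormedAddCommGroup E] [NormedSpace ℝ E]
    (hlam : 0 < lam) (F : Pos d → E) :
    ∫ z : Phase d, gibbsDensity U lam z • F z.1 =
      (∫ y, Real.exp (-U y / lam))⁻¹ • ∫ x, Real.exp (-U x / lam) • F x := by
  simp only [gibbsDensity_smul]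
  rw [integral_maxwellian_smul fun x => ((∫ y, Real.exp (-U y / lam)) *
    ∫ y : Pos d, maxwellian lam y)⁻¹ • (Real.exp (-U x / lam) • F x), integral_smul, smul_smul]
  congr 1
  have hM : 0 < ∫ y : Pos d, maxwellian lam y := integral_exp_pos (integrable_maxwellian hlam)
  field_simp

/-- Two separate cancellations: transport `-p · ∇_q ρ` against the force term `∇U · ∇_p ρ`, and the
friction `div_p (ρ p)` against the diffusion `lam Δ_p ρ`. -/
theorem kinetic_gibbsDensity_eq_zero (hlam : 0 < lam) (hU : Differentiable ℝ U)
    (hself : ∀ q, gradConv ψ (gibbsDensity U lam) q = gradient U q - gradient V q) (q p : Pos d) :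
    K V ψ lam (gibbsDensity U lam) (gibbsDensity U lam) q p = 0 := by
  set c := ((∫ y, Real.exp (-U y / lam)) * ∫ y : Pos d, maxwellian lam y)⁻¹
  have hρ : ∀ x y, gibbsDensity U lam (x, y) =
      c * Real.exp (-U x / lam) * maxwellian lam y := fun _ _ => rfl
  have hq : HasFDerivAt (fun x => c * Real.exp (-U x / lam) * maxwellian lam p)
      ((-lam⁻¹ * (c * Real.exp (-U q / lam) * maxwellian lam p)) • fderiv ℝ U q) q := by
    have h := ((((hU q).hasFDerivAt.const_mul (-lam⁻¹)).exp).const_mul c).mul_const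
      (maxwellian lam p)
    have he : ∀ x, -lam⁻¹ * U x = -U x / lam := fun x => by ring
    simp only [he] at h
    have he2 : (-lam⁻¹ * (c * Real.exp (-U q / lam) * maxwellian lam p)) • fderiv ℝ U q =
        maxwellian lam p • c • Real.exp (-U q / lam) • -lam⁻¹ • fderiv ℝ U q := by
      simp only [smul_smul]
      congr 1
      ring
    rw [he2]
    exact h
  have hp : HasFDerivAt (fun y => c * Real.exp (-U q / lam) * maxwellian lam y)
      ((c * Real.exp (-U q / lam)) • (-lam⁻¹ * maxwellian lam p) • innerSL ℝ p) p :=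
    (hasFDerivAt_maxwellian hlam p).const_mul _
  simp only [K, hρ, hself]
  rw [divergence_smul_const hq.differentiableAt, hq.fderiv, add_sub_cancel,
    divergence_smul_const_add hp.differentiableAt, hp.fderiv, laplacian_const_mul_maxwellian hlam]
  have hgrad : fderiv ℝ U q p = inner ℝ p (gradient U q) := by
    rw [real_inner_comm, inner_gradient_left]
  simp only [smul_apply, smul_eq_mul, innerSL_apply_apply, inner_add_right,
    real_inner_self_eq_norm_sq, hgrad]
  field_simp
  ring

end Stationary

end VFP

end

theorem mainTheorem8 (d : ℕ) (hd : 1 ≤ d) (V ψ : VFP.Pos d → ℝ)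
    (hV : VFP.ConfiningPotential V) (hψ : VFP.InteractionPotential ψ)
    (hVeven : Function.Even V) (hψeven : Function.Even ψ)
    (lam : ℝ) (hlam : 0 < lam) :
    ∃ (μ : MeasureTheory.Measure (VFP.Phase d)) (ρ : VFP.Phase d → ℝ),
      VFP.IsInvariantProbability V ψ lam μ ρ ∧ Function.Even ρ := by
  obtain ⟨U, hUs, hUeven, ⟨b, hb⟩, hint, hintψ, hintgrad, hself⟩ :=
    VFP.exists_selfConsistent_potential hV hψ hVeven hψeven hlam
  have hZ : 0 < ∫ y, Real.exp (-U y / lam) := integral_exp_pos hint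
  have hM : 0 < ∫ y : VFP.Pos d, VFP.maxwellian lam y :=
    integral_exp_pos (VFP.integrable_maxwellian hlam)
  have hint1 : Integrable (VFP.gibbsDensity U lam) := by
    simpa using VFP.integrable_gibbsDensity_smul (U := U) (F := fun _ => (1 : ℝ)) hlam
      (by simpa using hint)
  have hone : ∫ z, VFP.gibbsDensity U lam z = 1 := by
    have h := VFP.integral_gibbsDensity_smul (U := U) hlam fun _ => (1 : ℝ)
    simp only [smul_eq_mul, mul_one] at h
    rw [h, inv_mul_cancel₀ hZ.ne']
  have hnonneg : ∀ z, 0 ≤ VFP.gibbsDensity U lam z := fun z =>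
    mul_nonneg (mul_nonneg (by positivity) (Real.exp_pos _).le) (VFP.maxwellian_pos lam z.2).le
  refine ⟨volume.withDensity fun z => ENNReal.ofReal (VFP.gibbsDensity U lam z),
    VFP.gibbsDensity U lam, ⟨⟨?_⟩, hnonneg, rfl, ?_, hint1, ?_, fun q => ?_, fun q => ?_, ?_⟩, ?_⟩
  · rw [withDensity_apply _ MeasurableSet.univ, Measure.restrict_univ,
      ← ofReal_integral_eq_lintegral_ofReal hint1 (Eventually.of_forall hnonneg), hone,
      ENNReal.ofReal_one]
  · exact (contDiff_const.mul (Real.contDiff_exp.comp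
      ((hUs.comp contDiff_fst).neg.div_const lam))).mul
      ((VFP.contDiff_maxwellian lam).comp contDiff_snd)
  · refine ⟨((∫ y, Real.exp (-U y / lam)) * ∫ y : VFP.Pos d, VFP.maxwellian lam y)⁻¹ *
      Real.exp (-b / lam) * 1, fun z => ?_⟩
    rw [abs_of_nonneg (hnonneg z)]
    have h1 : Real.exp (-U z.1 / lam) ≤ Real.exp (-b / lam) := by
      have := hb z.1
      gcongr
    exact mul_le_mul (mul_le_mul_of_nonneg_left h1 (by positivity))
      (VFP.maxwellian_le_one hlam z.2) (VFP.maxwellian_pos lam z.2).le (by positivity)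
  · exact VFP.integrable_gibbsDensity_smul hlam (hintψ q)
  · exact VFP.integrable_gibbsDensity_smul hlam (hintgrad q)
  · refine VFP.kinetic_gibbsDensity_eq_zero hlam (hUs.differentiable (by simp)) fun q => ?_
    rw [VFP.gradConv, VFP.integral_gibbsDensity_smul hlam fun y => gradient ψ (q - y), hself,
      smul_smul, inv_mul_cancel₀ hZ.ne', one_smul]
  · intro z
    simp [VFP.gibbsDensity, VFP.maxwellian, hUeven z.1]
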